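/- For $\boldsymbol z\in\mathbb C^3$ let $\gamma(\boldsymbol z)=\sqrt{z_1^2+z_2^2+z_3^2}$ with the branch $\operatorname{Re}\gamma\ge 0$, and let $\phi(\boldsymbol z)=-\dfrac{1}{4\pi\gamma(\boldsymbol z)}$. For $\varepsilon>0$ let $\phi_\varepsilon(\boldsymbol z)=\phi(\boldsymbol z)$ if $\operatorname{Re}\gamma(\boldsymbol z)>\varepsilon$ and $\phi_\varepsilon(\boldsymbol z)=0$ otherwise. For fixed $\boldsymbol w\in\mathbb C^3$ let $\tilde\delta_\varepsilon(\boldsymbol x+\boldsymbol w)=\Delta_{\boldsymbol x}\,\phi_\varepsilon(\boldsymbol x+\boldsymbol w)$, the Laplacian in $\boldsymbol x\in\mathbb R^3$ being taken in the sense of distributions. Then, for every $\boldsymbol w\in\mathbb C^3$, the limit $$\tilde\delta(\boldsymbol x+\boldsymbol w)=\lim_{\varepsilon\to0^+}\tilde\delta_\varepsilon(\boldsymbol x+\boldsymbol w)$$ exists in the sense of distributions in $\boldsymbol x\in\mathbb R^3$. For every $\boldsymbol y\in\mathbb R^3$ the distribution $\tilde\delta(\boldsymbol x+i\boldsymbol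 y)$ has compact support in $\boldsymbol x$, and its monopole moment (total charge) and dipole moment are $$Q=\int_{\mathbb R^3}\tilde\delta(\boldsymbol x+i\boldsymbol y)\,d\boldsymbol x=1,\qquad \boldsymbol P=\int_{\mathbb R^3}\boldsymbol x\,\tilde\delta(\boldsymbol x+i\boldsymbol y)\,d\boldsymbol x=-i\boldsymbol y .$$ For every $\boldsymbol z_S\in\mathbb C^3$ the distribution $\tilde\delta(\boldsymbol x-\boldsymbol z_S)$ has compact support in $\boldsymbol x$, and the centroid of the source located at $\boldsymbol z_S$ is $$\boldsymbol C(\boldsymbol z_S)=\int_{\mathbb R^3}\boldsymbol x\,\tilde\delta(\boldsymbol x-\boldsymbol z_S)\,d\boldsymbol x=\boldsymbol z_S .$$ Here the integral of a smooth function $g$ against a compactly supported distribution $T$ is the value of $T$ on any test function that coincides with $g$ near the support of $T$. -/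

import Mathlib

open Filter Topology
open scoped Distributions

noncomputable section

namespace ComplexSource

/-- Physical space `ℝ³` with its Euclidean structure. -/
abbrev R3 : Type := EuclideanSpace ℝ (Fin 3)

/-- Complex space `ℂ³`. -/
abbrev C3 : Type := Fin 3 → ℂ

/-- The purely imaginary vector `i y ∈ ℂ³` for `y ∈ ℝ³`. -/
def imag (y : R3) : C3 := fun j => Complex.I * (y j : ℂ)

/-- The vector `x + w ∈ ℂ³` for `x ∈ ℝ³` and `w ∈ ℂ³`. -/
def shift (x : R3) (w : C3) : C3 := fun j => (x j : ℂ) + w j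

/-- The complex length `γ(z) = √(z · z)`, where `z · z = z₁² + z₂² + z₃²` (no conjugation).
The principal power is the branch of the root with `Re γ ≥ 0`. -/
def complexLength (z : C3) : ℂ := (∑ j, z j ^ 2) ^ (1 / 2 : ℂ)

/-- The holomorphic potential `φ(z) = -1 / (4 π γ(z))`. -/
def potential (z : C3) : ℂ := -1 / (4 * (Real.pi : ℂ) * complexLength z)

/-- The regularized potential `φ_ε(z) = θ(Re γ(z) - ε) φ(z)`, with `θ` the unit step function. -/
def regularizedPotential (ε : ℝ) (z : C3) : ℂ :=
  if ε < (complexLength z).re then potential z else 0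

/-- The action on the test function `f` of the regularized source `x ↦ δ̃_ε(x + w)`, the
distributional Laplacian in `x ∈ ℝ³` of the bounded function `x ↦ φ_ε(x + w)`. -/
def regularizedSource (w : C3) (ε : ℝ) (f : 𝓓((⊤ : TopologicalSpace.Opens R3), ℝ)) : ℂ :=
  ∫ x : R3, regularizedPotential ε (shift x w) *
    ((Laplacian.laplacian (fun x : R3 => f x) x : ℝ) : ℂ)

/-- `T` is the limit of the regularized sources `x ↦ δ̃_ε(x + w)` as `ε → 0⁺`, in the sense of
distributions. There is at most one such `T`. -/
def IsSource (w : C3) (T : 𝓓'((⊤ : TopologicalSpace.Opens R3), ℂ)) : Prop :=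
  ∀ f : 𝓓((⊤ : TopologicalSpace.Opens R3), ℝ),
    Tendsto (fun ε : ℝ => regularizedSource w ε f) (𝓝[>] 0) (𝓝 (T f))

open Classical in
/-- The extended source `x ↦ δ̃(x + w)`, as a complex distribution on `ℝ³`: the limit of the
regularized sources (and zero if there were no limit). -/
def source (w : C3) : 𝓓'((⊤ : TopologicalSpace.Opens R3), ℂ) :=
  if h : ∃ T, IsSource w T then h.choose else 0

/-- `∫ g(x) T(x) dx = c` for a compactly supported distribution `T` and a smooth function `g`, not
necessarily of compact support: `T` takes the value `c` on every test function that coincides with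
`g` in a neighbourhood of the support of `T`. -/
def HasIntegral (T : 𝓓'((⊤ : TopologicalSpace.Opens R3), ℂ)) (g : R3 → ℝ) (c : ℂ) : Prop :=
  IsCompact (Distribution.dsupport T) ∧
    ∀ f : 𝓓((⊤ : TopologicalSpace.Opens R3), ℝ),
      (∀ᶠ x in 𝓝ˢ (Distribution.dsupport T), f x = g x) → T f = c

/-- The total charge (monopole moment) `∫ T(x) dx` of `T` is `Q`. -/
def HasCharge (T : 𝓓'((⊤ : TopologicalSpace.Opens R3), ℂ)) (Q : ℂ) : Prop :=
  HasIntegral T (fun _ => 1) Q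

/-- The first moment `∫ x T(x) dx ∈ ℂ³` of `T` is `P`. -/
def HasFirstMoment (T : 𝓓'((⊤ : TopologicalSpace.Opens R3), ℂ)) (P : C3) : Prop :=
  ∀ j : Fin 3, HasIntegral T (fun x => x j) (P j)

end ComplexSource

end

namespace ComplexSource

/-! Off a null set `Re γ(x + w) > 0`, and `φ(x + w)` is locally integrable in `x`. Dominated
convergence therefore identifies the limit of the regularized sources with the distributional
Laplacian of `φ(x + w)` (`isSource_potentialLaplacian`).

The moments come from analytic continuation of the source point. Let `p`, `q` be the real and
imaginary parts of `w`. For real `t`, `φ(x + p + t q)` is the Newton potential with pole `-(p + t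
q)`, so its Laplacian paired with `f` is `f (-(p + t q))` (`integral_newton_mul_lap`). If `Δf = 0`
on a large ball, the pairing only sees `x` far from the singularities and is holomorphic for `|t| <
2`. When `f` is affine on that ball, the value on the real line is affine in `t`, and the identity
theorem carries it to `t = i`, where `p + t q = w` (`source_apply_of_affine`). Taking `f = 0` there
bounds the support; `f = 1` and `f = x_j` give charge and first moment. -/

open MeasureTheory LineDeriv

/-! ### Laplacians of test functions and integration by parts -/

/-- Real test functions on `ℝ³`. -/
abbrev TestFn : Type := 𝓓((⊤ : TopologicalSpace.Opens R3), ℝ)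

/-- The Laplacian of a test function, as a test function. -/
noncomputable abbrev lap : TestFn →L[ℝ] TestFn := laplacianCLM ℝ R3 TestFn

theorem lineDerivOp_apply (f : TestFn) (e x : R3) : (∂_{e} f) x = lineDeriv ℝ f x e :=
  TestFunction.lineDerivCLM_apply_of_le (𝕜 := ℝ) le_top

theorem hasLineDerivAt_testFn (f : TestFn) (e x : R3) :
    HasLineDerivAt ℝ f ((∂_{e} f) x) x e := by
  rw [lineDerivOp_apply]
  exact ((f.contDiff.differentiable (by simp)) x).lineDifferentiableAt.hasLineDerivAt

theorem lap_apply_eq_sum (f : TestFn) (x : R3) :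
    lap f x = ∑ i, (∂_{EuclideanSpace.basisFun (Fin 3) ℝ i}
      (∂_{EuclideanSpace.basisFun (Fin 3) ℝ i} f)) x := by
  rw [lap, laplacianCLM_eq_sum (EuclideanSpace.basisFun (Fin 3) ℝ)]
  simp only [Fin.sum_univ_three]
  rfl

theorem laplacian_eq_lap (f : TestFn) (x : R3) :
    Laplacian.laplacian (fun x : R3 => f x) x = lap f x := by
  rw [lap_apply_eq_sum, InnerProductSpace.laplacian_eq_iteratedFDeriv_orthonormalBasis _
    (EuclideanSpace.basisFun (Fin 3) ℝ)]
  refine Finset.sum_congr rfl fun i _ => ?_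
  rw [iteratedFDeriv_two_apply, lineDerivOp_apply]
  set e := EuclideanSpace.basisFun (Fin 3) ℝ i
  have h1 : ((∂_{e} f : TestFn) : R3 → ℝ) = fun y => fderiv ℝ f y e := by
    ext y
    rw [lineDerivOp_apply, ((f.contDiff.differentiable (by simp)) y).lineDeriv_eq_fderiv]
  have h2 : DifferentiableAt ℝ (fderiv ℝ f) x :=
    ((f.contDiff.fderiv_right (m := 1) (by norm_cast)).differentiable (by simp)) x
  rw [h1, (h2.clm_apply (differentiableAt_const _)).lineDeriv_eq_fderiv,
    fderiv_clm_apply h2 (differentiableAt_const _)]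
  simp

theorem integral_mul_lineDerivOp_lineDerivOp (f : TestFn) {G G' G'' : R3 → ℝ} {e : R3}
    (hG : Continuous G) (hG' : Continuous G') (hG'' : Continuous G'')
    (h1 : ∀ x, HasLineDerivAt ℝ G (G' x) x e) (h2 : ∀ x, HasLineDerivAt ℝ G' (G'' x) x e) :
    ∫ x, G x * (∂_{e} (∂_{e} f)) x = ∫ x, G'' x * f x := by
  have hint : ∀ {H : R3 → ℝ} (_ : Continuous H) (g : TestFn),
      Integrable (fun x => H x * g x) := fun hH g =>
    (hH.mul g.continuous).integrable_of_hasCompactSupport g.hasCompactSupport.mul_left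
  have e1 := integral_bilinear_hasLineDerivAt_right_eq_neg_left_of_integrable
    (μ := volume) (B := ContinuousLinearMap.mul ℝ ℝ) (hint hG' (∂_{e} f))
    (hint hG (∂_{e} (∂_{e} f))) (hint hG (∂_{e} f)) (fun x _ => h1 x)
    (fun x _ => hasLineDerivAt_testFn (∂_{e} f) e x)
  have e2 := integral_bilinear_hasLineDerivAt_right_eq_neg_left_of_integrable
    (μ := volume) (B := ContinuousLinearMap.mul ℝ ℝ) (hint hG'' f)
    (hint hG' (∂_{e} f)) (hint hG' f) (fun x _ => h2 x)
    (fun x _ => hasLineDerivAt_testFn f e x)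
  simp only [ContinuousLinearMap.mul_apply'] at e1 e2
  rw [e1, e2, neg_neg]

/-! ### The fundamental solution of the Laplacian -/

/-- The normalized Laplacian of the regularized Newton potential. -/
noncomputable def peakKernel (x : R3) : ℝ :=
  3 / (4 * Real.pi) * (‖x‖ ^ 2 + 1) ^ (-(5 / 2) : ℝ)

theorem integral_sq_mul_rpow :
    ∫ r in Set.Ioi (0 : ℝ), 3 * r ^ 2 * (r ^ 2 + 1) ^ (-(5 / 2) : ℝ) = 1 := by
  -- An explicit primitive, equal to 0 at the origin and tending to 1 at infinity.
  have hd : ∀ r ∈ Set.Ici (0 : ℝ), HasDerivAt (fun r : ℝ => r ^ 3 * (r ^ 2 + 1) ^ (-(3 / 2) : ℝ))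
      (3 * r ^ 2 * (r ^ 2 + 1) ^ (-(5 / 2) : ℝ)) r := by
    intro r _
    have hu : (0 : ℝ) < r ^ 2 + 1 := by positivity
    have h1 : HasDerivAt (fun r : ℝ => r ^ 2 + 1) (2 * r) r := by
      simpa using (hasDerivAt_pow 2 r).add_const 1
    refine ((hasDerivAt_pow 3 r).mul (h1.rpow_const (p := -(3 / 2)) (Or.inl hu.ne'))).congr_deriv ?_
    rw [show (-(3 / 2) - 1 : ℝ) = -(5 / 2) by norm_num,
      show (-(3 / 2) : ℝ) = -(5 / 2) + 1 by norm_num, Real.rpow_add_one hu.ne']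
    push_cast
    ring
  have hlim : Tendsto (fun r : ℝ => r ^ 3 * (r ^ 2 + 1) ^ (-(3 / 2) : ℝ)) atTop (𝓝 1) := by
    have h : Tendsto (fun r : ℝ => (1 + r⁻¹ ^ 2) ^ (-(3 / 2) : ℝ)) atTop (𝓝 1) := by
      have h0 : Tendsto (fun r : ℝ => 1 + r⁻¹ ^ 2) atTop (𝓝 1) := by
        simpa using (tendsto_inv_atTop_zero.pow 2).const_add (1 : ℝ)
      simpa using h0.rpow_const (p := -(3 / 2)) (Or.inl one_ne_zero)
    refine h.congr' ?_
    filter_upwards [eventually_gt_atTop 0] with r hr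
    have : r ^ 2 + 1 = r ^ 2 * (1 + r⁻¹ ^ 2) := by field_simp
    have h2 : (r ^ 2) ^ (-(3 / 2) : ℝ) = (r ^ 3)⁻¹ := by
      rw [← Real.rpow_natCast, ← Real.rpow_natCast, ← Real.rpow_mul hr.le, ← Real.rpow_neg hr.le]
      norm_num
    rw [this, Real.mul_rpow (by positivity) (by positivity), h2]
    field_simp
  rw [integral_Ioi_of_hasDerivAt_of_tendsto' hd
    (integrableOn_Ioi_deriv_of_nonneg' hd (fun r _ => by positivity) hlim) hlim]
  simp

theorem integral_peakKernel : ∫ x, peakKernel x = 1 := by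
  have h := integral_fun_norm_addHaar (volume : Measure R3)
    (fun r => 3 / (4 * Real.pi) * (r ^ 2 + 1) ^ (-(5 / 2) : ℝ))
  have hb : (volume : Measure R3).real (Metric.ball 0 1) = Real.pi * 4 / 3 := by
    simp [Measure.real, EuclideanSpace.volume_ball_fin_three]
    positivity
  have e : (fun r : ℝ => r ^ 2 * (3 / (4 * Real.pi) * (r ^ 2 + 1) ^ (-(5 / 2) : ℝ))) =
      fun r => (4 * Real.pi)⁻¹ * (3 * r ^ 2 * (r ^ 2 + 1) ^ (-(5 / 2) : ℝ)) := by
    ext r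
    ring
  simp only [finrank_euclideanSpace, Fintype.card_fin, hb, smul_eq_mul, nsmul_eq_mul,
    Nat.add_one_sub_one, e, integral_const_mul, integral_sq_mul_rpow] at h
  simp only [peakKernel, integral_const_mul, h]
  push_cast
  field_simp

/-- The decay hypothesis for `peakKernel` to generate an approximate identity by dilation. -/
theorem tendsto_norm_pow_mul_peakKernel :
    Tendsto (fun x : R3 => ‖x‖ ^ Module.finrank ℝ R3 * peakKernel x)
      (Bornology.cobounded R3) (𝓝 0) := by
  have hinv : Tendsto (fun x : R3 => 3 / (4 * Real.pi) * ‖x‖⁻¹) (Bornology.cobounded R3) (𝓝 0) := by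
    simpa using (tendsto_inv_atTop_zero.comp tendsto_norm_cobounded_atTop).const_mul
      (3 / (4 * Real.pi))
  refine squeeze_zero' (Eventually.of_forall fun x => by unfold peakKernel; positivity) ?_ hinv
  filter_upwards [tendsto_norm_cobounded_atTop.eventually_ge_atTop 1] with x hx
  have h0 : 0 < ‖x‖ := by linarith
  have h1 : (‖x‖ ^ 2 + 1) ^ (-(5 / 2) : ℝ) ≤ (‖x‖ ^ 2) ^ (-(5 / 2) : ℝ) :=
    Real.rpow_le_rpow_of_nonpos (by positivity) (by linarith) (by norm_num)
  have h2 : (‖x‖ ^ 2) ^ (-(5 / 2) : ℝ) = (‖x‖ ^ 5)⁻¹ := by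
    rw [← Real.rpow_natCast, ← Real.rpow_natCast, ← Real.rpow_mul h0.le, ← Real.rpow_neg h0.le]
    norm_num
  simp only [finrank_euclideanSpace, Fintype.card_fin, peakKernel]
  calc ‖x‖ ^ 3 * (3 / (4 * Real.pi) * (‖x‖ ^ 2 + 1) ^ (-(5 / 2) : ℝ))
      ≤ ‖x‖ ^ 3 * (3 / (4 * Real.pi) * (‖x‖ ^ 5)⁻¹) := by rw [← h2]; gcongr
    _ = 3 / (4 * Real.pi) * (‖x‖ ^ 2)⁻¹ := by field_simp
    _ ≤ 3 / (4 * Real.pi) * ‖x‖⁻¹ := by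
        gcongr
        nlinarith

/-- The Newton potential with pole at `a`, regularized at scale `c⁻¹`. -/
noncomputable def smoothedNewton (a : R3) (c : ℝ) (x : R3) : ℝ :=
  -(c / (4 * Real.pi)) * (c ^ 2 * ‖x - a‖ ^ 2 + 1) ^ (-(1 / 2) : ℝ)

theorem hasDerivAt_quadratic (a x e : R3) (c : ℝ) :
    HasDerivAt (fun t : ℝ => c ^ 2 * ‖x + t • e - a‖ ^ 2 + 1) (2 * c ^ 2 * inner ℝ (x - a) e) 0 := by
  have h : HasDerivAt (fun t : ℝ => x + t • e - a) e 0 := by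
    simpa using (((hasDerivAt_id (0 : ℝ)).smul_const e).const_add x).sub_const a
  refine (((h.norm_sq).const_mul (c ^ 2)).add_const 1).congr_deriv ?_
  simp only [zero_smul, add_zero]
  ring

theorem continuous_quadratic_rpow (a : R3) (c s : ℝ) :
    Continuous fun x : R3 => (c ^ 2 * ‖x - a‖ ^ 2 + 1) ^ s :=
  Continuous.rpow_const (by fun_prop) fun x => Or.inl (by positivity)

theorem hasLineDerivAt_quadratic_rpow (a x e : R3) (c s : ℝ) :
    HasLineDerivAt ℝ (fun x : R3 => (c ^ 2 * ‖x - a‖ ^ 2 + 1) ^ s)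
      (2 * c ^ 2 * inner ℝ (x - a) e * s * (c ^ 2 * ‖x - a‖ ^ 2 + 1) ^ (s - 1)) x e := by
  have h := (hasDerivAt_quadratic a x e c).rpow_const (p := s) (Or.inl (by positivity))
  simp only [zero_smul, add_zero] at h
  exact h

/-- With `u = c²|x - a|² + 1`, the second derivatives in an orthonormal basis sum to a multiple of
`3 u^(-3/2) - 3 c²|x - a|² u^(-5/2) = 3 u^(-5/2)`, a dilated `peakKernel`. -/
theorem integral_smoothedNewton_mul_lap (f : TestFn) (a : R3) (c : ℝ) :
    ∫ x, smoothedNewton a c x * lap f x =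
      ∫ x, (c ^ Module.finrank ℝ R3 * peakKernel (c • (a - x))) • f x := by
  let G' : R3 → R3 → ℝ := fun e x =>
    c ^ 3 / (4 * Real.pi) * (inner ℝ (x - a) e * (c ^ 2 * ‖x - a‖ ^ 2 + 1) ^ (-(3 / 2) : ℝ))
  let G'' : R3 → R3 → ℝ := fun e x =>
    c ^ 3 / (4 * Real.pi) * (inner ℝ e e * (c ^ 2 * ‖x - a‖ ^ 2 + 1) ^ (-(3 / 2) : ℝ) -
      3 * c ^ 2 * inner ℝ (x - a) e ^ 2 * (c ^ 2 * ‖x - a‖ ^ 2 + 1) ^ (-(5 / 2) : ℝ))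
  have cG : Continuous (smoothedNewton a c) :=
    continuous_const.mul (continuous_quadratic_rpow a c _)
  have cG' : ∀ e, Continuous (G' e) := fun e =>
    continuous_const.mul ((by fun_prop : Continuous fun x : R3 => inner ℝ (x - a) e).mul
      (continuous_quadratic_rpow a c _))
  have cG'' : ∀ e, Continuous (G'' e) := fun e =>
    continuous_const.mul ((continuous_const.mul (continuous_quadratic_rpow a c _)).sub
      ((by fun_prop : Continuous fun x : R3 => 3 * c ^ 2 * inner ℝ (x - a) e ^ 2).mul
        (continuous_quadratic_rpow a c _)))
  have h1 : ∀ e x, HasLineDerivAt ℝ (smoothedNewton a c) (G' e x) x e := by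
    intro e x
    refine ((hasLineDerivAt_quadratic_rpow a x e c (-(1 / 2))).const_mul
      (-(c / (4 * Real.pi)))).congr_deriv ?_
    simp only [G']
    rw [show (-(1 / 2) - 1 : ℝ) = -(3 / 2) by norm_num]
    ring
  have h2 : ∀ e x, HasLineDerivAt ℝ (G' e) (G'' e x) x e := by
    intro e x
    have hi : HasDerivAt (fun t : ℝ => inner ℝ (x + t • e - a) e) (inner ℝ e e) 0 := by
      have h : HasDerivAt (fun t : ℝ => x + t • e - a) e 0 := by
        simpa using (((hasDerivAt_id (0 : ℝ)).smul_const e).const_add x).sub_const a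
      simpa using h.inner ℝ (hasDerivAt_const (0 : ℝ) e)
    refine ((HasDerivAt.mul hi (hasLineDerivAt_quadratic_rpow a x e c (-(3 / 2)))).const_mul
      (c ^ 3 / (4 * Real.pi))).congr_deriv ?_
    rw [show (-(3 / 2) - 1 : ℝ) = -(5 / 2) by norm_num]
    simp only [zero_smul, add_zero, G'']
    ring
  have hint : ∀ {H : R3 → ℝ} (_ : Continuous H) (g : TestFn),
      Integrable (fun x => H x * g x) := fun hH g =>
    (hH.mul g.continuous).integrable_of_hasCompactSupport g.hasCompactSupport.mul_left
  simp only [lap_apply_eq_sum, Finset.mul_sum]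
  rw [integral_finsetSum _ fun i _ => hint cG _]
  simp only [integral_mul_lineDerivOp_lineDerivOp f cG (cG' _) (cG'' _) (h1 _) (h2 _)]
  rw [← integral_finsetSum _ fun i _ => hint (cG'' _) f]
  refine integral_congr_ae (Eventually.of_forall fun x => ?_)
  simp only [← Finset.sum_mul, smul_eq_mul]
  congr 1
  have hu : 0 < c ^ 2 * ‖x - a‖ ^ 2 + 1 := by positivity
  have hn : ‖x - a‖ ^ 2 = ∑ i, inner ℝ (x - a) (EuclideanSpace.basisFun (Fin 3) ℝ i) ^ 2 := by
    rw [← (EuclideanSpace.basisFun (Fin 3) ℝ).sum_sq_norm_inner_left]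
    simp
  have h3 : ‖c • (a - x)‖ ^ 2 = c ^ 2 * ‖x - a‖ ^ 2 := by
    rw [norm_smul, mul_pow, norm_sub_rev, Real.norm_eq_abs, sq_abs]
  have h4 : ∀ i, inner ℝ (EuclideanSpace.basisFun (Fin 3) ℝ i)
      (EuclideanSpace.basisFun (Fin 3) ℝ i) = (1 : ℝ) := fun i => by simp
  simp only [G'', ← Finset.mul_sum, Finset.sum_sub_distrib, ← Finset.sum_mul, ← hn, peakKernel, h3,
    h4, finrank_euclideanSpace, Fintype.card_fin]
  rw [show (-(3 / 2) : ℝ) = -(5 / 2) + 1 by norm_num, Real.rpow_add_one hu.ne']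
  simp
  ring

theorem locallyIntegrable_comp_sub_right {F : Type*} [NormedAddCommGroup F] {g : R3 → F}
    (hg : LocallyIntegrable g) (a : R3) : LocallyIntegrable fun x => g (x - a) := by
  intro x
  obtain ⟨s, hs, hi⟩ := hg (x - a)
  refine ⟨(fun y => y - a) ⁻¹' s, (continuous_sub_right a).continuousAt.preimage_mem_nhds hs, ?_⟩
  exact (measurePreserving_sub_right volume a).integrableOn_comp_preimage
    (MeasurableEquiv.subRight a).measurableEmbedding |>.2 hi

theorem locallyIntegrable_newton (a : R3) :
    LocallyIntegrable fun x : R3 => 1 / (4 * Real.pi * ‖x - a‖) := by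
  refine locallyIntegrable_comp_sub_right (g := fun x => 1 / (4 * Real.pi * ‖x‖)) ?_ a
  refine locallyIntegrable_of_norm_le_rpow (C := 1 / (4 * Real.pi)) (α := 1) (by simp)
    (by simp) (Eventually.of_forall fun x => ?_)
    (by measurability : Measurable _).aestronglyMeasurable
  rw [Real.rpow_neg_one, Real.norm_of_nonneg (by positivity)]
  apply le_of_eq
  field_simp

/-- `-1 / (4π|x - a|)` is the fundamental solution of the Laplacian with pole at `a`. -/
theorem integral_newton_mul_lap (f : TestFn) (a : R3) :
    ∫ x, -(1 / (4 * Real.pi * ‖x - a‖)) * lap f x = f a := by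
  -- The limit `c → ∞` is computed twice: here by concentration at `a`, below by dominated
  -- convergence to the Newton potential.
  have hpeak : Tendsto (fun c : ℝ => ∫ x, smoothedNewton a c x * lap f x) atTop (𝓝 (f a)) := by
    simp only [integral_smoothedNewton_mul_lap]
    exact tendsto_integral_comp_smul_smul_of_integrable'
      (fun x => by unfold peakKernel; positivity) integral_peakKernel
      tendsto_norm_pow_mul_peakKernel
      (f.continuous.integrable_of_hasCompactSupport f.hasCompactSupport) f.continuous.continuousAt
  have hloc := locallyIntegrable_newton a
  have hbound : Integrable (fun x => 1 / (4 * Real.pi * ‖x - a‖) * ‖lap f x‖) := by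
    have := hloc.integrable_smul_right_of_hasCompactSupport (g := fun x => ‖lap f x‖)
      (lap f).continuous.norm (lap f).hasCompactSupport.norm
    simpa [mul_comm] using this
  have hform : ∀ x, ∀ c > 0, smoothedNewton a c x =
      -(1 / (4 * Real.pi * √(‖x - a‖ ^ 2 + c⁻¹ ^ 2))) := by
    intro x c hc
    have e : c ^ 2 * ‖x - a‖ ^ 2 + 1 = c ^ 2 * (‖x - a‖ ^ 2 + c⁻¹ ^ 2) := by field_simp
    have hs : 0 < √(‖x - a‖ ^ 2 + c⁻¹ ^ 2) := Real.sqrt_pos.2 (by positivity)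
    rw [smoothedNewton, e, Real.rpow_neg (by positivity), ← Real.sqrt_eq_rpow,
      Real.sqrt_mul (by positivity), Real.sqrt_sq hc.le]
    field_simp
  have hpt : ∀ x, x ≠ a → Tendsto (fun c : ℝ => smoothedNewton a c x) atTop
      (𝓝 (-(1 / (4 * Real.pi * ‖x - a‖)))) := by
    intro x hx
    have hpos : 0 < ‖x - a‖ := norm_pos_iff.2 (sub_ne_zero.2 hx)
    have h0 : Tendsto (fun c : ℝ => √(‖x - a‖ ^ 2 + c⁻¹ ^ 2)) atTop (𝓝 ‖x - a‖) := by
      have := ((tendsto_inv_atTop_zero (𝕜 := ℝ)).pow 2).const_add (‖x - a‖ ^ 2) |>.sqrt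
      simpa [Real.sqrt_sq hpos.le] using this
    refine ((tendsto_const_nhds (x := (1 : ℝ))).div (h0.const_mul (4 * Real.pi))
      (by positivity)).neg.congr' ?_
    filter_upwards [eventually_gt_atTop 0] with c hc
    exact (hform x c hc).symm
  have hle : ∀ x, x ≠ a → ∀ c > 0, ‖smoothedNewton a c x‖ ≤ 1 / (4 * Real.pi * ‖x - a‖) := by
    intro x hx c hc
    have hpos : 0 < ‖x - a‖ := norm_pos_iff.2 (sub_ne_zero.2 hx)
    rw [hform x c hc, norm_neg, Real.norm_of_nonneg (by positivity)]
    gcongr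
    exact Real.le_sqrt_of_sq_le (by nlinarith [sq_nonneg c⁻¹])
  have hne : ∀ᵐ x : R3, x ≠ a := by simp [ae_iff]
  refine tendsto_nhds_unique (tendsto_integral_filter_of_dominated_convergence _
    (Eventually.of_forall fun c => ?_) ?_ hbound ?_) hpeak
  · exact ((continuous_const.mul (continuous_quadratic_rpow a c _)).mul
      (lap f).continuous).aestronglyMeasurable
  · filter_upwards [eventually_gt_atTop 0] with c hc
    filter_upwards [hne] with x hx
    rw [norm_mul]
    gcongr
    exact hle x hx c hc
  · filter_upwards [hne] with x hx
    exact (hpt x hx).mul_const _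

/-! ### The complex square and its root -/

/-- The real part of a vector of `ℂ³`. -/
noncomputable def rePart (w : C3) : R3 := WithLp.toLp 2 fun j => (w j).re

/-- The imaginary part of a vector of `ℂ³`. -/
noncomputable def imPart (w : C3) : R3 := WithLp.toLp 2 fun j => (w j).im

/-- The complex square `(a + i b) · (a + i b)`. -/
noncomputable def complexSq (a b : R3) : ℂ := ⟨‖a‖ ^ 2 - ‖b‖ ^ 2, 2 * inner ℝ a b⟩

theorem sum_shift_sq (x : R3) (w : C3) :
    ∑ j, shift x w j ^ 2 = complexSq (x + rePart w) (imPart w) := by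
  have hn : ∀ v : R3, ‖v‖ ^ 2 = v 0 * v 0 + v 1 * v 1 + v 2 * v 2 := fun v => by
    rw [EuclideanSpace.norm_sq_eq]
    simp [Fin.sum_univ_three, pow_two]
  apply Complex.ext
  · simp only [complexSq, hn]
    simp [Fin.sum_univ_three, shift, rePart, imPart, pow_two]
    ring
  · simp [Fin.sum_univ_three, shift, complexSq, rePart, imPart, PiLp.inner_apply, pow_two]
    ring

theorem potential_shift (x : R3) (w : C3) :
    potential (shift x w) =
      -1 / (4 * (Real.pi : ℂ) * complexSq (x + rePart w) (imPart w) ^ (1 / 2 : ℂ)) := by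
  rw [potential, complexLength, sum_shift_sq]

theorem norm_cpow_half (z : ℂ) : ‖z ^ (1 / 2 : ℂ)‖ = ‖z‖ ^ (1 / 2 : ℝ) := by
  rw [← Complex.norm_cpow_real]
  norm_num

/-- The principal root halves the argument, which off the cut lies strictly between `-π` and `π`. -/
theorem re_cpow_half_pos {z : ℂ} (hz : z ∈ Complex.slitPlane) : 0 < (z ^ (1 / 2 : ℂ)).re := by
  rw [Complex.cpow_def_of_ne_zero (Complex.slitPlane_ne_zero hz), Complex.exp_re]
  refine mul_pos (Real.exp_pos _) (Real.cos_pos_of_mem_Ioo ?_)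
  have h1 := Complex.neg_pi_lt_arg z
  have h2 := lt_of_le_of_ne (Complex.arg_le_pi z) (Complex.mem_slitPlane_iff_arg.1 hz).1
  have h3 : (Complex.log z * (1 / 2 : ℂ)).im = z.arg / 2 := by
    rw [show (1 / 2 : ℂ) = ((1 / 2 : ℝ) : ℂ) by norm_num, Complex.im_mul_ofReal, Complex.log_im]
    ring
  rw [h3]
  constructor <;> linarith

theorem norm_potential_shift (x : R3) (w : C3) :
    ‖potential (shift x w)‖ =
      1 / (4 * Real.pi * ‖complexSq (x + rePart w) (imPart w)‖ ^ (1 / 2 : ℝ)) := by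
  rw [potential_shift, norm_div, norm_mul, norm_cpow_half]
  simp [abs_of_pos Real.pi_pos]

theorem ae_inner_ne_zero {q : R3} (hq : q ≠ 0) : ∀ᵐ x : R3, inner ℝ x q ≠ 0 := by
  have h := Measure.addHaar_submodule (volume : Measure R3) (ℝ ∙ q)ᗮ (by
    rw [Ne, Submodule.orthogonal_eq_top_iff, Submodule.span_singleton_eq_bot]
    exact hq)
  rw [ae_iff]
  convert h using 2
  ext x
  simp [Submodule.mem_orthogonal_singleton_iff_inner_left]

theorem ae_complexSq_mem_slitPlane (w : C3) :
    ∀ᵐ x : R3, complexSq (x + rePart w) (imPart w) ∈ Complex.slitPlane := by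
  have h : ∀ᵐ x : R3, complexSq x (imPart w) ∈ Complex.slitPlane := by
    by_cases hq : imPart w = 0
    · have hne : ∀ᵐ x : R3, x ≠ 0 := by simp [ae_iff]
      filter_upwards [hne] with x hx
      left
      have := norm_pos_iff.2 hx
      simpa [complexSq, hq] using pow_pos (norm_pos_iff.2 hx) 2
    · filter_upwards [ae_inner_ne_zero hq] with x hx
      right
      simpa [complexSq] using hx
  exact (measurePreserving_add_right volume (rePart w)).quasiMeasurePreserving.ae h

/-! ### Local integrability of the complex potential -/

theorem exists_orthonormalBasis_inner_eq (q : R3) (hq : q ≠ 0) :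
    ∃ b : OrthonormalBasis (Fin 3) ℝ R3, ∀ x, inner ℝ x q = ‖q‖ * b.repr x 0 := by
  have hnq : ‖q‖ ≠ 0 := norm_ne_zero_iff.2 hq
  have hv : Orthonormal ℝ (({0} : Set (Fin 3)).domRestrict fun _ => ‖q‖⁻¹ • q) := by
    refine ⟨fun i => ?_, fun i j hij => (hij (Subsingleton.elim i j)).elim⟩
    change ‖‖q‖⁻¹ • q‖ = 1
    simp [norm_smul, hnq]
  obtain ⟨b, hb⟩ := hv.exists_orthonormalBasis_extension_of_card_eq (by simp)
  refine ⟨b, fun x => ?_⟩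
  rw [b.repr_apply_apply, hb 0 rfl, real_inner_smul_left, real_inner_comm]
  field_simp

theorem integrableOn_pi_abs_rpow (R : ℝ) :
    IntegrableOn (fun u : Fin 3 → ℝ => |u 0| ^ (-(1 / 2) : ℝ))
      (Set.univ.pi fun _ => Set.Icc (-R) R) := by
  have h1 : LocallyIntegrable fun t : ℝ => |t| ^ (-(1 / 2) : ℝ) :=
    locallyIntegrable_of_norm_le_rpow (C := 1) (α := 1 / 2) (by simp) (by norm_num)
      (Eventually.of_forall fun t => by
        rw [one_mul, Real.norm_of_nonneg (by positivity), Real.norm_eq_abs])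
      (by measurability : Measurable _).aestronglyMeasurable
  let g : Fin 3 → ℝ → ℝ := ![fun t => |t| ^ (-(1 / 2) : ℝ), fun _ => 1, fun _ => 1]
  have hg : ∀ i, IntegrableOn (g i) (Set.Icc (-R) R) := by
    intro i
    fin_cases i
    · exact h1.integrableOn_isCompact isCompact_Icc
    · exact integrableOn_const (by simp)
    · exact integrableOn_const (by simp)
  have h := Integrable.fintype_prod hg
  rw [IntegrableOn, volume_pi, Measure.restrict_pi_pi]
  simpa [Fin.prod_univ_three, g] using h

/-- In an orthonormal basis starting with `q/|q|` this is a one-variable power with exponent `-1/2 >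
-1`, integrable on cubes by Fubini. -/
theorem locallyIntegrable_abs_inner_rpow {q : R3} (hq : q ≠ 0) :
    LocallyIntegrable fun x : R3 => |inner ℝ x q| ^ (-(1 / 2) : ℝ) := by
  have hnq : 0 < ‖q‖ := norm_pos_iff.2 hq
  rw [locallyIntegrable_iff]
  intro K hK
  obtain ⟨R, -, hR⟩ := hK.isBounded.exists_pos_norm_lt
  obtain ⟨b, hb⟩ := exists_orthonormalBasis_inner_eq q hq
  let e : R3 ≃ᵐ (Fin 3 → ℝ) :=
    b.measurableEquiv.trans (MeasurableEquiv.toLp 2 (Fin 3 → ℝ)).symm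
  have he : MeasurePreserving e volume volume :=
    (PiLp.volume_preserving_ofLp (Fin 3)).comp b.measurePreserving_repr
  have h := ((he.integrableOn_comp_preimage e.measurableEmbedding).2
    (integrableOn_pi_abs_rpow R)).const_mul (‖q‖ ^ (-(1 / 2) : ℝ))
  have hf : (fun x : R3 => |inner ℝ x q| ^ (-(1 / 2) : ℝ)) =
      fun x => ‖q‖ ^ (-(1 / 2) : ℝ) * ((fun u : Fin 3 → ℝ => |u 0| ^ (-(1 / 2) : ℝ)) ∘ e) x := by
    ext x
    rw [hb, abs_mul, abs_norm, Real.mul_rpow (by positivity) (by positivity)]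
    rfl
  rw [hf]
  refine IntegrableOn.mono_set h fun x hx i _ => ?_
  change b.repr x i ∈ Set.Icc (-R) R
  rw [b.repr_apply_apply]
  refine abs_le.1 ((abs_real_inner_le_norm _ _).trans ?_)
  simpa using (hR x hx).le

theorem measurable_complexLength : Measurable complexLength := by
  unfold complexLength
  fun_prop

theorem measurable_potential : Measurable potential := by
  unfold potential
  exact measurable_const.div (measurable_const.mul measurable_complexLength)

theorem measurable_regularizedPotential (ε : ℝ) : Measurable (regularizedPotential ε) :=
  Measurable.ite (measurableSet_lt measurable_const
    (Complex.measurable_re.comp measurable_complexLength)) measurable_potential measurable_const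

theorem measurable_shift (w : C3) : Measurable fun x : R3 => shift x w := by
  unfold shift
  fun_prop

/-- If `q = Im w ≠ 0`, then `|γ|² ≥ |Im γ²| = 2|⟨x + Re w, q⟩|`. This bounds `φ` by a function
singular on a whole plane but still locally integrable. If `q = 0`, `φ` is a Newton potential. -/
theorem locallyIntegrable_potential_shift (w : C3) :
    LocallyIntegrable fun x : R3 => potential (shift x w) := by
  have hm : AEStronglyMeasurable fun x : R3 => potential (shift x w) :=
    (measurable_potential.comp (measurable_shift w)).aestronglyMeasurable
  by_cases hq : imPart w = 0
  · refine (locallyIntegrable_newton (-rePart w)).mono hm (Eventually.of_forall fun x => ?_)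
    have h : complexSq (x + rePart w) 0 = ((‖x + rePart w‖ ^ 2 : ℝ) : ℂ) := by
      rw [complexSq, norm_zero, inner_zero_right, mul_zero, zero_pow two_ne_zero, sub_zero]
      rfl
    rw [norm_potential_shift, hq, h, Complex.norm_real, Real.norm_of_nonneg (by positivity),
      ← Real.sqrt_eq_rpow, Real.sqrt_sq (norm_nonneg _), sub_neg_eq_add]
    exact le_abs_self _
  · have h := locallyIntegrable_comp_sub_right (locallyIntegrable_abs_inner_rpow hq) (-rePart w)
    refine h.mono hm ?_
    have hae := (measurePreserving_add_right volume (rePart w)).quasiMeasurePreserving.ae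
      (ae_inner_ne_zero hq)
    filter_upwards [hae] with x hx
    rw [norm_potential_shift, sub_neg_eq_add, Real.norm_of_nonneg (by positivity),
      Real.rpow_neg (abs_nonneg _), one_div]
    have hpos : 0 < |inner ℝ (x + rePart w) (imPart w)| := abs_pos.2 hx
    gcongr
    have h1 : |inner ℝ (x + rePart w) (imPart w)| ≤ ‖complexSq (x + rePart w) (imPart w)‖ := by
      refine le_trans ?_ (Complex.abs_im_le_norm _)
      simp only [complexSq, abs_mul, abs_two]
      linarith
    have h2 : (1 : ℝ) ≤ 4 * Real.pi := by linarith [Real.pi_gt_three]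
    calc _ ≤ 1 * ‖complexSq (x + rePart w) (imPart w)‖ ^ (1 / 2 : ℝ) := by
          rw [one_mul]
          gcongr
      _ ≤ _ := by gcongr

/-! ### Existence of the limit -/

/-- The distributional Laplacian of `x ↦ φ(x + w)`. -/
noncomputable def potentialLaplacian (w : C3) : 𝓓'((⊤ : TopologicalSpace.Opens R3), ℂ) :=
  (TestFunction.integralAgainstBilinCLM (ContinuousLinearMap.lsmul ℝ ℝ) volume
    (fun x : R3 => potential (shift x w)) : TestFn →L[ℝ] ℂ) ∘L lap

theorem potentialLaplacian_apply (w : C3) (f : TestFn) :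
    potentialLaplacian w f = ∫ x : R3, potential (shift x w) * ((lap f x : ℝ) : ℂ) := by
  have h := TestFunction.integralAgainstBilinCLM_eq_integral
    (B := ContinuousLinearMap.lsmul ℝ ℝ) (f := lap f)
    ((locallyIntegrable_potential_shift w).locallyIntegrableOn _)
  refine h.trans (integral_congr_ae (Eventually.of_forall fun x => ?_))
  simp [mul_comm]

theorem tendsto_regularizedPotential {z : C3} (hz : 0 < (complexLength z).re) :
    Tendsto (fun ε : ℝ => regularizedPotential ε z) (𝓝[>] 0) (𝓝 (potential z)) := by
  refine tendsto_const_nhds.congr' ?_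
  filter_upwards [mem_nhdsWithin_of_mem_nhds (Iio_mem_nhds hz)] with ε hε
  exact (if_pos hε).symm

theorem isSource_potentialLaplacian (w : C3) : IsSource w (potentialLaplacian w) := by
  intro f
  simp only [regularizedSource, laplacian_eq_lap, potentialLaplacian_apply]
  have hint : Integrable fun x => ‖potential (shift x w)‖ * ‖lap f x‖ := by
    have := (locallyIntegrable_potential_shift w).integrable_smul_left_of_hasCompactSupport
      (lap f).continuous (lap f).hasCompactSupport
    simpa [norm_smul, mul_comm] using this.norm
  refine tendsto_integral_filter_of_dominated_convergence _
    (Eventually.of_forall fun ε => ?_) (Eventually.of_forall fun ε => ?_) hint ?_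
  · exact (((measurable_regularizedPotential ε).comp (measurable_shift w)).mul
      (Complex.measurable_ofReal.comp (lap f).continuous.measurable)).aestronglyMeasurable
  · refine Eventually.of_forall fun x => ?_
    rw [norm_mul, Complex.norm_real]
    gcongr
    unfold regularizedPotential
    split_ifs
    · exact le_rfl
    · simp
  · filter_upwards [ae_complexSq_mem_slitPlane w] with x hx
    refine (tendsto_regularizedPotential ?_).mul_const _
    rw [complexLength, sum_shift_sq]
    exact re_cpow_half_pos hx

theorem isSource_source (w : C3) : IsSource w (source w) := by
  have h : ∃ T, IsSource w T := ⟨_, isSource_potentialLaplacian w⟩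
  rw [source, dif_pos h]
  exact h.choose_spec

/-- `source` is obtained by choice, but uniqueness of limits in `ℂ` forces its values. -/
theorem source_apply (w : C3) (f : TestFn) :
    source w f = ∫ x : R3, potential (shift x w) * ((lap f x : ℝ) : ℂ) := by
  rw [← potentialLaplacian_apply]
  exact tendsto_nhds_unique (isSource_source w f) (isSource_potentialLaplacian w f)

/-! ### Continuation along a complex line of source points -/

theorem differentiableOn_setIntegral {h h' : ℂ → R3 → ℂ} {U : Set ℂ} {K : Set R3} (hU : IsOpen U)
    (hK : IsCompact K) (hc : ∀ t ∈ U, ContinuousOn (h t) K)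
    (hc' : ContinuousOn (Function.uncurry h') (U ×ˢ K))
    (hd : ∀ t ∈ U, ∀ x ∈ K, HasDerivAt (fun s => h s x) (h' t x) t) :
    DifferentiableOn ℂ (fun t => ∫ x in K, h t x) U := by
  intro t₀ ht₀
  obtain ⟨ε, hε, hεU⟩ := Metric.nhds_basis_closedBall.mem_iff.1 (hU.mem_nhds ht₀)
  obtain ⟨C, hC⟩ := ((isCompact_closedBall t₀ ε).prod hK).exists_bound_of_continuousOn
    (hc'.mono (Set.prod_mono_left hεU))
  have hs : Metric.ball t₀ ε ⊆ U := Metric.ball_subset_closedBall.trans hεU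
  refine (hasDerivAt_integral_of_dominated_loc_of_deriv_le (F' := h') (bound := fun _ => C)
    (Metric.ball_mem_nhds t₀ hε) ?_ ((hc t₀ ht₀).integrableOn_compact hK) ?_ ?_
    (integrableOn_const hK.measure_ne_top) ?_).2.differentiableAt.differentiableWithinAt
  · filter_upwards [hU.mem_nhds ht₀] with t ht
    exact (hc t ht).aestronglyMeasurable hK.measurableSet
  · refine ContinuousOn.aestronglyMeasurable ?_ hK.measurableSet
    exact hc'.comp (by fun_prop : ContinuousOn (fun x => (t₀, x)) K) fun x hx => ⟨ht₀, hx⟩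
  · refine (ae_restrict_iff' hK.measurableSet).2 (Eventually.of_forall fun x hx t ht => ?_)
    exact hC (t, x) ⟨Metric.ball_subset_closedBall ht, hx⟩
  · exact (ae_restrict_iff' hK.measurableSet).2
      (Eventually.of_forall fun x hx t ht => hd t (hs ht) x hx)

theorem differentiableOn_setIntegral_cpow {S S' : ℂ → R3 → ℂ} {g : R3 → ℂ} {U : Set ℂ}
    {K : Set R3} (s : ℂ) (hU : IsOpen U) (hK : IsCompact K)
    (hS : Continuous (Function.uncurry S)) (hS' : Continuous (Function.uncurry S'))
    (hg : Continuous g) (hmem : ∀ t ∈ U, ∀ x ∈ K, S t x ∈ Complex.slitPlane)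
    (hd : ∀ t ∈ U, ∀ x ∈ K, HasDerivAt (fun s => S s x) (S' t x) t) :
    DifferentiableOn ℂ (fun t => ∫ x in K, S t x ^ s * g x) U := by
  have hcpow : ∀ s : ℂ, ContinuousOn (fun z : ℂ × R3 => Function.uncurry S z ^ s) (U ×ˢ K) :=
    fun s => hS.continuousOn.cpow continuousOn_const fun z hz => hmem z.1 hz.1 z.2 hz.2
  refine differentiableOn_setIntegral (h' := fun t x => s * S t x ^ (s - 1) * S' t x * g x)
    hU hK ?_ ?_ ?_
  · intro t ht
    have h1 : ContinuousOn (fun x => S t x ^ s) K :=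
      (hcpow s).comp (by fun_prop : ContinuousOn (fun x => (t, x)) K) fun x hx => ⟨ht, hx⟩
    exact h1.mul hg.continuousOn
  · exact ((continuousOn_const.mul (hcpow (s - 1))).mul hS'.continuousOn).mul
      (hg.comp continuous_snd).continuousOn
  · intro t ht x hx
    exact ((hd t ht x hx).cpow_const (hmem t ht x hx)).mul_const _

/-- The complex line `t ↦ p + t q` in `ℂ³` spanned by real vectors. -/
noncomputable def complexLine (p q : R3) (t : ℂ) : C3 := fun j => (p j : ℂ) + t * (q j : ℂ)

theorem rePart_complexLine (p q : R3) (t : ℂ) : rePart (complexLine p q t) = p + t.re • q := by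
  ext j
  simp [rePart, complexLine]

theorem imPart_complexLine (p q : R3) (t : ℂ) : imPart (complexLine p q t) = t.im • q := by
  ext j
  simp [imPart, complexLine]

theorem complexLine_I (w : C3) : complexLine (rePart w) (imPart w) Complex.I = w := by
  ext j
  simp [rePart, imPart, complexLine, mul_comm Complex.I, Complex.re_add_im]

theorem potential_shift_complexLine_ofReal (x p q : R3) (t : ℝ) :
    potential (shift x (complexLine p q t)) =
      ((-(1 / (4 * Real.pi * ‖x - -(p + t • q)‖)) : ℝ) : ℂ) := by
  have h : complexSq (x + (p + t • q)) 0 = ((‖x + (p + t • q)‖ ^ 2 : ℝ) : ℂ) := by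
    rw [complexSq, norm_zero, inner_zero_right, mul_zero, zero_pow two_ne_zero, sub_zero]
    rfl
  rw [potential_shift, rePart_complexLine, imPart_complexLine, Complex.ofReal_re,
    Complex.ofReal_im, zero_smul, h, show (1 / 2 : ℂ) = ((1 / 2 : ℝ) : ℂ) by norm_num,
    ← Complex.ofReal_cpow (by positivity), ← Real.sqrt_eq_rpow, Real.sqrt_sq (norm_nonneg _),
    sub_neg_eq_add]
  push_cast
  ring

theorem source_complexLine_ofReal (p q : R3) (t : ℝ) (f : TestFn) :
    ∫ x : R3, potential (shift x (complexLine p q t)) * ((lap f x : ℝ) : ℂ) =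
      (f (-(p + t • q)) : ℂ) := by
  simp only [potential_shift_complexLine_ofReal, ← Complex.ofReal_mul]
  rw [integral_complex_ofReal, integral_newton_mul_lap]

/-- For `|t| < 2`, `|x + p + (Re t) q| ≥ R - |p| - 2|q| > 2|q| ≥ |(Im t) q|`, so the complex square
has positive real part. Radius 2 leaves room for `t = i`. -/
theorem mem_slitPlane_of_norm_lt {p q x : R3} {R : ℝ} (hR : ‖p‖ + 4 * ‖q‖ < R) (hx : R ≤ ‖x‖)
    {t : ℂ} (ht : t ∈ Metric.ball (0 : ℂ) 2) :
    ∑ j, shift x (complexLine p q t) j ^ 2 ∈ Complex.slitPlane := by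
  rw [sum_shift_sq, rePart_complexLine, imPart_complexLine]
  left
  rw [mem_ball_zero_iff] at ht
  have h1 : ‖t.re • q‖ ≤ 2 * ‖q‖ := by
    rw [norm_smul]
    gcongr
    exact (Complex.abs_re_le_norm t).trans ht.le
  have h2 : ‖t.im • q‖ ≤ 2 * ‖q‖ := by
    rw [norm_smul]
    gcongr
    exact (Complex.abs_im_le_norm t).trans ht.le
  have h3 : ‖x‖ ≤ ‖x + (p + t.re • q)‖ + (‖p‖ + ‖t.re • q‖) := by
    calc ‖x‖ = ‖x + (p + t.re • q) - (p + t.re • q)‖ := by rw [add_sub_cancel_right]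
      _ ≤ _ := (norm_sub_le _ _).trans (by gcongr; exact norm_add_le _ _)
  have h4 : ‖t.im • q‖ < ‖x + (p + t.re • q)‖ := by linarith
  simp only [complexSq, sub_pos]
  gcongr

theorem differentiableOn_integral_potential_complexLine {p q : R3} {R : ℝ}
    (hR : ‖p‖ + 4 * ‖q‖ < R) {f : TestFn} (hf : ∀ x, ‖x‖ < R → lap f x = 0) :
    DifferentiableOn ℂ (fun t => ∫ x : R3, potential (shift x (complexLine p q t)) *
      ((lap f x : ℝ) : ℂ)) (Metric.ball 0 2) := by
  -- The integrand vanishes off this compact set, on which the root stays away from its cut.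
  set K : Set R3 := tsupport (lap f) ∩ (Metric.ball 0 R)ᶜ with hKdef
  have hK : IsCompact K := (lap f).hasCompactSupport.inter_right Metric.isOpen_ball.isClosed_compl
  have hKR : ∀ x ∈ K, R ≤ ‖x‖ := fun x hx => by simpa using hx.2
  have hset : (fun t => ∫ x : R3, potential (shift x (complexLine p q t)) *
      ((lap f x : ℝ) : ℂ)) = fun t => ∫ x in K, potential (shift x (complexLine p q t)) *
      ((lap f x : ℝ) : ℂ) := by
    ext t
    refine (setIntegral_eq_integral_of_forall_compl_eq_zero fun x hx => ?_).symm
    have h0 : lap f x = 0 := by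
      by_cases hxt : x ∈ tsupport (lap f)
      · exact hf x (by simpa [hKdef, hxt] using hx)
      · exact image_eq_zero_of_notMem_tsupport hxt
    simp [h0]
  rw [hset]
  have hpot : ∀ t, ∀ x, potential (shift x (complexLine p q t)) * ((lap f x : ℝ) : ℂ) =
      (∑ j, shift x (complexLine p q t) j ^ 2) ^ (-(1 / 2) : ℂ) *
        (-(4 * (Real.pi : ℂ))⁻¹ * ((lap f x : ℝ) : ℂ)) := by
    intro t x
    rw [potential, complexLength, Complex.cpow_neg, neg_div, one_div, mul_inv]
    ring
  simp only [hpot]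
  refine differentiableOn_setIntegral_cpow
    (S' := fun t x => ∑ j, 2 * shift x (complexLine p q t) j * (q j : ℂ)) _ Metric.isOpen_ball hK
    ?_ ?_ ?_ (fun t ht x hx => mem_slitPlane_of_norm_lt hR (hKR x hx) ht) fun t ht x hx => ?_
  · unfold shift complexLine Function.uncurry
    fun_prop
  · unfold shift complexLine Function.uncurry
    fun_prop
  · exact continuous_const.mul (Complex.continuous_ofReal.comp (lap f).continuous)
  · refine HasDerivAt.fun_sum fun j _ => ?_
    have h1 : HasDerivAt (fun s => shift x (complexLine p q s) j) (q j : ℂ) t := by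
      unfold shift complexLine
      simpa using (((hasDerivAt_id t).mul_const (q j : ℂ)).const_add (p j : ℂ)).const_add
        (x j : ℂ)
    simpa using h1.fun_pow 2

/-- Analytic continuation from real to complex source points. -/
theorem source_apply_eq_of_real_line {w : C3} {R : ℝ}
    (hR : ‖rePart w‖ + 4 * ‖imPart w‖ < R) {f : TestFn} (hf : ∀ x, ‖x‖ < R → lap f x = 0)
    {c₀ c₁ : ℂ}
    (hc : ∀ t : ℝ, |t| < 2 → (f (-(rePart w + t • imPart w)) : ℂ) = c₀ + c₁ * t) :
    source w f = c₀ + c₁ * Complex.I := by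
  have h1 := (differentiableOn_integral_potential_complexLine hR hf).analyticOnNhd
    Metric.isOpen_ball
  have h2 : AnalyticOnNhd ℂ (fun t : ℂ => c₀ + c₁ * t) (Metric.ball 0 2) := fun t _ => by fun_prop
  -- Agreement at real points accumulating at 0 suffices for the identity theorem.
  have hfreq : ∃ᶠ t in 𝓝[≠] (0 : ℂ), (∫ x : R3, potential
      (shift x (complexLine (rePart w) (imPart w) t)) * ((lap f x : ℝ) : ℂ)) = c₀ + c₁ * t := by
    have hmap : Tendsto (fun t : ℝ => (t : ℂ)) (𝓝[≠] 0) (𝓝[≠] 0) := by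
      refine tendsto_nhdsWithin_iff.2 ⟨?_, ?_⟩
      · exact (Complex.continuous_ofReal.tendsto' 0 0 (by simp)).mono_left nhdsWithin_le_nhds
      · filter_upwards [self_mem_nhdsWithin] with t ht
        simpa using ht
    refine hmap.frequently (Eventually.frequently ?_)
    filter_upwards [mem_nhdsWithin_of_mem_nhds (Metric.ball_mem_nhds (0 : ℝ) two_pos)] with t ht
    rw [source_complexLine_ofReal]
    exact hc t (by simpa using ht)
  have h := h1.eqOn_of_preconnected_of_frequently_eq h2
    (convex_ball (0 : ℂ) 2).isPreconnected (Metric.mem_ball_self two_pos) hfreq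
    (show Complex.I ∈ Metric.ball (0 : ℂ) 2 by simp)
  simpa only [complexLine_I, ← source_apply] using h

/-! ### Support and moments of the source -/

open scoped Manifold ContDiff

/-- The product of a test function with a smooth function. -/
noncomputable def smoothMul (g : R3 → ℝ) (hg : ContDiff ℝ ∞ g) (f : TestFn) : TestFn where
  toFun := fun x => g x * f x
  contDiff' := hg.mul f.contDiff
  hasCompactSupport' := f.hasCompactSupport.mul_left
  tsupport_subset' := by simp

/-- A distribution vanishes on the test functions that vanish near its support. -/
theorem apply_eq_zero_of_eventually_nhdsSet {T : 𝓓'((⊤ : TopologicalSpace.Opens R3), ℂ)}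
    {f : TestFn} (hf : ∀ᶠ x in 𝓝ˢ (Distribution.dsupport T), f x = 0) : T f = 0 := by
  let ι := {s : Set R3 // Distribution.IsVanishingOn T s ∧ IsOpen s}
  have hcover : tsupport f ⊆ ⋃ i : ι, (i : Set R3) := by
    intro x hx
    have hxd : x ∉ Distribution.dsupport T := fun h =>
      (notMem_tsupport_iff_eventuallyEq.2 (hf.filter_mono (nhds_le_nhdsSet h))) hx
    obtain ⟨s, hs, hso, hxs⟩ := (Distribution.notMem_dsupport_iff x).1 hxd
    exact Set.mem_iUnion.2 ⟨⟨s, hs, hso⟩, hxs⟩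
  -- The partition of unity splits `f` into pieces, each supported in an open set where `T`
  -- vanishes; compactness leaves finitely many.
  obtain ⟨ρ, hρ⟩ := SmoothPartitionOfUnity.exists_isSubordinate 𝓘(ℝ, R3)
    (isClosed_tsupport f) (fun i : ι => (i : Set R3)) (fun i => i.2.2) hcover
  have hfin := ρ.locallyFinite.finite_nonempty_inter_compact f.hasCompactSupport
  have hsum : f = ∑ i ∈ hfin.toFinset, smoothMul (ρ i) (ρ i).contMDiff.contDiff f := by
    ext x
    have hcoe : (∑ i ∈ hfin.toFinset, smoothMul (ρ i) (ρ i).contMDiff.contDiff f) x =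
        ∑ i ∈ hfin.toFinset, ρ i x * f x := by
      rw [FunLike.coe_sum, Finset.sum_apply]
      rfl
    rw [hcoe, ← Finset.sum_mul]
    by_cases hx : x ∈ tsupport f
    · have h1 := ρ.sum_eq_one hx
      rw [finsum_eq_sum_of_support_subset _ (s := hfin.toFinset)] at h1
      · rw [h1, one_mul]
      · intro i hi
        simpa using ⟨x, hi, hx⟩
    · rw [image_eq_zero_of_notMem_tsupport hx, mul_zero]
  rw [hsum, map_sum]
  refine Finset.sum_eq_zero fun i _ => i.2.1 _ ?_
  exact (tsupport_mul_subset_left (f := ρ i) (g := f)).trans (hρ i)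

theorem lap_apply_eq_zero_of_affine {f : TestFn} {L : R3 →L[ℝ] ℝ} {k : ℝ} {x : R3}
    (h : ∀ᶠ y in 𝓝 x, f y = L y + k) : lap f x = 0 := by
  have h' : (fun y => f y) =ᶠ[𝓝 x] fun y => L y + k := h
  have hd : fderiv ℝ (fun y => L y + k) = fun _ => L := by
    ext1 y
    rw [fderiv_add_const, L.fderiv]
  rw [← laplacian_eq_lap, (InnerProductSpace.laplacian_congr_nhds h').eq_of_nhds,
    InnerProductSpace.laplacian_eq_iteratedFDeriv_stdOrthonormalBasis]
  simp [iteratedFDeriv_two_apply, hd]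

theorem source_apply_of_affine {w : C3} {R : ℝ} (hR : ‖rePart w‖ + 4 * ‖imPart w‖ < R)
    {f : TestFn} {L : R3 →L[ℝ] ℝ} {k : ℝ} (hf : ∀ x, ‖x‖ < R → f x = L x + k) :
    source w f = k - (L (rePart w) + L (imPart w) * Complex.I) := by
  have hlap : ∀ x, ‖x‖ < R → lap f x = 0 := fun x hx => by
    refine lap_apply_eq_zero_of_affine (L := L) (k := k) ?_
    filter_upwards [Metric.isOpen_ball.mem_nhds (mem_ball_zero_iff.2 hx)] with y hy
    exact hf y (mem_ball_zero_iff.1 hy)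
  rw [source_apply_eq_of_real_line hR hlap (c₀ := k - L (rePart w)) (c₁ := -L (imPart w))]
  · ring
  · intro t ht
    rw [hf]
    · simp only [map_neg, map_add, map_smul, smul_eq_mul]
      push_cast
      ring
    · rw [norm_neg]
      have h1 : ‖t • imPart w‖ ≤ 2 * ‖imPart w‖ := by
        rw [norm_smul, Real.norm_eq_abs]
        gcongr
      have := norm_add_le (rePart w) (t • imPart w)
      have := norm_nonneg (imPart w)
      linarith

/-- A test function supported outside the ball is affine on it with `L = 0`, `k = 0`, so the source
annihilates it. -/
theorem dsupport_source_subset {w : C3} {R : ℝ} (hR : ‖rePart w‖ + 4 * ‖imPart w‖ < R) :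
    Distribution.dsupport (source w) ⊆ Metric.closedBall 0 R := by
  intro x hx
  refine (Distribution.mem_dsupport_iff x).1 hx _ (fun f hf => ?_) Metric.isClosed_closedBall
  have h := source_apply_of_affine hR (f := f) (L := 0) (k := 0) fun y hy => by
    rw [image_eq_zero_of_notMem_tsupport fun hyt => hf hyt (by simpa using hy.le)]
    simp
  simpa using h

theorem hasIntegral_source_affine (w : C3) (L : R3 →L[ℝ] ℝ) (k : ℝ) :
    HasIntegral (source w) (fun x => L x + k)
      (k - (L (rePart w) + L (imPart w) * Complex.I)) := by
  set R : ℝ := ‖rePart w‖ + 4 * ‖imPart w‖ + 1 with hRdef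
  have hR : ‖rePart w‖ + 4 * ‖imPart w‖ < R := lt_add_one _
  have hRpos : 0 < R := by positivity
  refine ⟨(isCompact_closedBall (0 : R3) R).of_isClosed_subset Distribution.isClosed_dsupport
    (dsupport_source_subset hR), fun f hf => ?_⟩
  -- Cutting off beyond radius `R + 1` keeps the function affine on a neighbourhood of the support,
  -- so `f - f₀` vanishes there.
  let χ : ContDiffBump (0 : R3) := ⟨R + 1, R + 2, by linarith, by linarith⟩
  let f₀ : TestFn := smoothMul (fun x => L x + k) (L.contDiff.add contDiff_const)
    ⟨χ, χ.contDiff, χ.hasCompactSupport, by simp⟩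
  have hf₀ : ∀ x, ‖x‖ < R + 1 → f₀ x = L x + k := fun x hx => by
    change (L x + k) * χ x = _
    rw [χ.one_of_mem_closedBall (mem_closedBall_zero_iff.2 hx.le), mul_one]
  rw [← source_apply_of_affine (hR.trans (lt_add_one R)) hf₀, ← sub_eq_zero, ← map_sub]
  refine apply_eq_zero_of_eventually_nhdsSet ?_
  have hball : Metric.ball (0 : R3) (R + 1) ∈ 𝓝ˢ (Distribution.dsupport (source w)) :=
    Metric.isOpen_ball.mem_nhdsSet.2 ((dsupport_source_subset hR).trans
      (Metric.closedBall_subset_ball (lt_add_one R)))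
  filter_upwards [hf, hball] with x hx hxb
  change f x - f₀ x = 0
  rw [hx, hf₀ x (mem_ball_zero_iff.1 hxb), sub_self]

theorem hasCharge_source (w : C3) : HasCharge (source w) 1 := by
  simpa [HasCharge] using hasIntegral_source_affine w 0 1

theorem hasFirstMoment_source (w : C3) : HasFirstMoment (source w) (-w) := by
  intro j
  have h := hasIntegral_source_affine w (EuclideanSpace.proj j) 0
  simpa [rePart, imPart, Complex.re_add_im] using h

end ComplexSource


theorem proposition4 :
    -- the extended sources exist as distributions
    (∀ w : ComplexSource.C3, ComplexSource.IsSource w (ComplexSource.source w)) ∧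
    -- total charge and dipole moment of `δ̃(x + i y)`
    (∀ y : ComplexSource.R3,
      ComplexSource.HasCharge (ComplexSource.source (ComplexSource.imag y)) 1 ∧
      ComplexSource.HasFirstMoment (ComplexSource.source (ComplexSource.imag y))
        (-ComplexSource.imag y)) ∧
    -- centroid of the source `δ̃(x - z_S)`
    (∀ zS : ComplexSource.C3,
      ComplexSource.HasFirstMoment (ComplexSource.source (-zS)) zS) := by
  refine ⟨ComplexSource.isSource_source, fun y => ⟨ComplexSource.hasCharge_source _,
    ComplexSource.hasFirstMoment_source _⟩, fun zS => ?_⟩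
  simpa using ComplexSource.hasFirstMoment_source (-zS)
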